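/- Let $G$ be a connected (finite-dimensional, real) Lie group, $H\subseteq G$ a compact connected subgroup, $\pi:G\to G/H$ the projection, $p_0=H$, where $G/H$ carries the smooth structure for which $\pi$ is a submersion. Let $\mathcal G$ be a $G$-invariant smooth Riemannian metric tensor field on $G/H$ with Riemannian distance $d_{\mathcal G}$. Let $\exp_G:T_eG\to G$ be the Lie group exponential, and let $\log_G:G\to V$ be a logarithm with range in a neighbourhood $V\subseteq T_eG$ of $0$, i.e. $\exp_G\circ\log_G=\mathrm{id}_G$ and $\log_G\circ\exp_G|_V=\mathrm{id}_V$; assume that $\log_G$ maps compact sets to relatively compact sets (as it does when $\exp_G|_V:V\to G$ is a diffeomorphism, e.g. when $V=T_eG$). For $p\in G/H$, viewed as a coset, put $$\rho_{\mathcal G}(p)=\inf_{g\in p}\sqrt{\mathcal G(\pi_*\log_G g,\ \pi_*\log_G g)} .$$ For $t>0$ define functions $G/H\to\mathbb R\cup\{\infty\}$: for $\alpha\in(1/2,1]$, with $\nu_\alpha=\frac{2\alpha-1}{(2\alpha)^{2\alpha/(2\alpha-1)}}$, $$k_t^{\alpha}(p)=\nu_\alpha t^{-\frac1{2\alpha-1}}d_{\mathcal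 G}(p_0,p)^{\frac{2\alpha}{2\alpha-1}},\qquad k_t^{\alpha,\mathrm{appr}}(p)=\nu_\alpha t^{-\frac1{2\alpha-1}}\rho_{\mathcal G}(p)^{\frac{2\alpha}{2\alpha-1}},$$ and for $\alpha=1/2$ let $k_t^{1/2}(p)$ be $0$ if $d_{\mathcal G}(p_0,p)\le t$ and $\infty$ otherwise, and let $k_t^{1/2,\mathrm{appr}}(p)$ be $0$ if $\rho_{\mathcal G}(p)\le t$ and $\infty$ otherwise. Then: 1. For all $\alpha\in(1/2,1]$, $t>0$ and $p\in G/H$: $k_t^\alpha(p)\le k_t^{\alpha,\mathrm{appr}}(p)$. 2. For every compact $K\subseteq G/H$ there is a constant $C_{\mathrm{metr}}\ge 1$ with $d_{\mathcal G}(p_0,p)\le\rho_{\mathcal G}(p)\le C_{\mathrm{metr}}\,d_{\mathcal G}(p_0,p)$ for all $p\in K$; and for every such constant, all $\alpha\in(1/2,1]$, all $t>0$ and all $p\in K$, $$k_t^{\alpha,\mathrm{appr}}(p)\le C_{\mathrm{metr}}^{\frac{2\alpha}{2\alpha-1}}\,k_t^\alpha(p).$$ 3. For $\alpha=1/2$,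 all $t>0$ and all $p\in G/H$: if $\rho_{\mathcal G}(p)\le t$ then $k_t^{1/2,\mathrm{appr}}(p)=k_t^{1/2}(p)=0$; if $d_{\mathcal G}(p_0,p)>t$ then $k_t^{1/2,\mathrm{appr}}(p)=k_t^{1/2}(p)=\infty$; and if $\rho_{\mathcal G}(p)>t$ and $d_{\mathcal G}(p_0,p)\le t$ then $k_t^{1/2,\mathrm{appr}}(p)=\infty$ while $k_t^{1/2}(p)=0$. -/

import Mathlib

open Set Filter Topology Manifold Bundle
open scoped ContDiff

noncomputable section

section LieExponential

variable {E : Type*} [NormedAddCommGroup E] [NormedSpace ℝ E]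
  {G : Type*} [TopologicalSpace G] [ChartedSpace E G] [Group G]

open Classical in
/-- The Lie group exponential map `exp_G : T_e G → G`: the value at time `1` of the integral curve
through the identity of the left-invariant vector field generated by `X`.  (On a Lie group this
curve exists for all times and is unique, so the `else` branch is never used.) -/
def lieExp (X : GroupLieAlgebra 𝓘(ℝ, E) G) : G :=
  if h : ∃ γ : ℝ → G, γ 0 = 1 ∧
      IsMIntegralCurve (I := 𝓘(ℝ, E)) γ (mulInvariantVectorField X) then h.choose 1 else 1

/-- `log` is a logarithm of the Lie group `G` with range `V ⊆ T_e G`: `exp_G ∘ log = id_G`,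
`log ∘ exp_G = id` on `V`, the set `V` is a neighbourhood of `0`, and `log` maps compact sets to
relatively compact sets.  The last two properties hold whenever `exp_G` restricts to a
diffeomorphism (or homeomorphism) from a neighbourhood `V` of `0` onto `G`, in particular when
`V = T_e G`; they also hold when `V` is not open, as for `SE(2)` with the angle in `[-π, π)`. -/
structure IsLieLog (V : Set (GroupLieAlgebra 𝓘(ℝ, E) G)) (log : G → GroupLieAlgebra 𝓘(ℝ, E) G) :
    Prop where
  mem : ∀ g, log g ∈ V
  exp_log : ∀ g, lieExp (log g) = g
  log_exp : ∀ X ∈ V, log (lieExp X) = X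
  mem_nhds : V ∈ 𝓝 (0 : GroupLieAlgebra 𝓘(ℝ, E) G)
  locallyBounded : ∀ S : Set G, IsCompact S →
    ∃ B : Set (GroupLieAlgebra 𝓘(ℝ, E) G), IsCompact B ∧ MapsTo log S B

end LieExponential

section Metric

/-- A smooth Riemannian metric tensor field on a manifold `M`. -/
abbrev MetricTensorField (F : Type*) [NormedAddCommGroup F] [NormedSpace ℝ F]
    (M : Type*) [TopologicalSpace M] [ChartedSpace F M] [IsManifold 𝓘(ℝ, F) ∞ M] :=
  ContMDiffRiemannianMetric 𝓘(ℝ, F) ∞ F (fun p : M => TangentSpace 𝓘(ℝ, F) p)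

/-- The Riemannian distance `d_𝒢` of a metric tensor field: the infimum of the lengths
`∫₀¹ √(𝒢(β', β')) dt` of the curves connecting the two points. -/
def metricDist {F : Type*} [NormedAddCommGroup F] [NormedSpace ℝ F]
    {M : Type*} [TopologicalSpace M] [ChartedSpace F M] [IsManifold 𝓘(ℝ, F) ∞ M]
    (𝒢 : MetricTensorField F M) (p q : M) : ℝ :=
  letI : RiemannianBundle (fun p : M => TangentSpace 𝓘(ℝ, F) p) := ⟨𝒢.toRiemannianMetric⟩
  (riemannianEDist 𝓘(ℝ, F) p q).toReal

end Metric

section HomogeneousSpace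

variable {E : Type*} [NormedAddCommGroup E] [NormedSpace ℝ E]
  {F : Type*} [NormedAddCommGroup F] [NormedSpace ℝ F]
  {G : Type*} [TopologicalSpace G] [ChartedSpace E G] [Group G]
  {H : Subgroup G} [ChartedSpace F (G ⧸ H)]

/-- The pushforward `π_* : T_e G → T_{p₀} (G/H)` of the projection `π : G → G/H` at the identity. -/
def projPushforward (F : Type*) [NormedAddCommGroup F] [NormedSpace ℝ F] (H : Subgroup G)
    [ChartedSpace F (G ⧸ H)] (X : GroupLieAlgebra 𝓘(ℝ, E) G) :
    TangentSpace 𝓘(ℝ, F) (QuotientGroup.mk 1 : G ⧸ H) :=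
  mfderiv 𝓘(ℝ, E) 𝓘(ℝ, F) (QuotientGroup.mk : G → G ⧸ H) 1 X

variable [IsManifold 𝓘(ℝ, F) ∞ (G ⧸ H)]

/-- `G`-invariance of a metric tensor field on `G/H`: every left translation `L_g : p ↦ g p`
is an isometry on tangent spaces. -/
def MetricTensorField.IsInvariant (𝒢 : MetricTensorField F (G ⧸ H)) : Prop :=
  ∀ (g : G) (p : G ⧸ H) (v w : TangentSpace 𝓘(ℝ, F) p),
    𝒢.inner (g • p) (mfderiv 𝓘(ℝ, F) 𝓘(ℝ, F) (fun q : G ⧸ H => g • q) p v)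
      (mfderiv 𝓘(ℝ, F) 𝓘(ℝ, F) (fun q : G ⧸ H => g • q) p w) = 𝒢.inner p v w

/-- The seminorm `‖X‖ = √(𝒢(π_* X, π_* X))` on `T_e G` induced by `𝒢`. -/
def inducedSeminorm (𝒢 : MetricTensorField F (G ⧸ H)) (X : GroupLieAlgebra 𝓘(ℝ, E) G) : ℝ :=
  √(𝒢.inner (QuotientGroup.mk 1) (projPushforward F H X) (projPushforward F H X))

/-- The logarithmic metric estimate `ρ_𝒢(p) = inf_{g ∈ p} ‖log g‖`, where the point `p` of `G/H`
is a left coset of `H`. -/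
def logMetricEstimate (𝒢 : MetricTensorField F (G ⧸ H)) (log : G → GroupLieAlgebra 𝓘(ℝ, E) G)
    (p : G ⧸ H) : ℝ :=
  ⨅ g : {g : G // (QuotientGroup.mk g : G ⧸ H) = p}, inducedSeminorm 𝒢 (log g)

/-- The distance `d_𝒢(p₀, p)` to the reference point `p₀ = H`. -/
def distToBase (𝒢 : MetricTensorField F (G ⧸ H)) (p : G ⧸ H) : ℝ :=
  metricDist 𝒢 (QuotientGroup.mk 1) p

/-- `C ≥ 1` is an admissible constant `C_metr` on the set `K ⊆ G/H`:
`d_𝒢(p₀, p) ≤ ρ_𝒢(p) ≤ C d_𝒢(p₀, p)` for `p ∈ K`. -/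
def IsMetricConstant (𝒢 : MetricTensorField F (G ⧸ H)) (log : G → GroupLieAlgebra 𝓘(ℝ, E) G)
    (K : Set (G ⧸ H)) (C : ℝ) : Prop :=
  1 ≤ C ∧ ∀ p ∈ K, distToBase 𝒢 p ≤ logMetricEstimate 𝒢 log p ∧
    logMetricEstimate 𝒢 log p ≤ C * distToBase 𝒢 p

/-- The constant `ν_α = (2α - 1) / (2α)^(2α/(2α-1))`. -/
def morphNu (α : ℝ) : ℝ := (2 * α - 1) / (2 * α) ^ (2 * α / (2 * α - 1))

/-- The morphological kernel as a function of `α`, `t` and the radius `r`, with values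
in `ℝ ∪ {∞}`. -/
def morphProfile (α t r : ℝ) : EReal :=
  if α = 1 / 2 then (if r ^ (2 * α) ≤ t then 0 else ⊤)
  else ((morphNu α * t ^ (-(1 / (2 * α - 1))) * r ^ (2 * α / (2 * α - 1)) : ℝ) : EReal)

/-- The exact dilation/erosion kernel `k_t^α`. -/
def morphKernel (𝒢 : MetricTensorField F (G ⧸ H)) (α t : ℝ) (p : G ⧸ H) : EReal :=
  morphProfile α t (distToBase 𝒢 p)

/-- The approximate dilation/erosion kernel `k_t^{α,appr}`. -/
def approxMorphKernel (𝒢 : MetricTensorField F (G ⧸ H)) (log : G → GroupLieAlgebra 𝓘(ℝ, E) G)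
    (α t : ℝ) (p : G ⧸ H) : EReal :=
  morphProfile α t (logMetricEstimate 𝒢 log p)

end HomogeneousSpace

end

/-! The kernel profile is increasing and homogeneous in the radius, so everything reduces to `d ≤ ρ`
on all of `G ⧸ H` and `ρ ≤ C d` on compact sets.

For `d ≤ ρ`: each `g` in the coset `p` is the endpoint of the integral curve through `1` of the
left-invariant field of `X = log g`. Since `𝒢` is invariant, the projected curve has constant speed
`‖X‖`, so it joins `p₀` to `p` with length `‖log g‖`; then take the infimum over the coset
(`metricEDist_mk_lieExp_le`).

For `ρ ≤ C d`: by compactness a bound near each point suffices. Near a point other than `p₀`, `ρ` is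
bounded above and `d` is bounded below by a positive number. Near `p₀`, `d` dominates the chart
distance (`eventually_edist_extChartAt_le_riemannianEDist`). The differential of `π ∘ exp` at `0` is
surjective, because that of `exp` is the identity and `π` is a submersion; so the inverse function
theorem gives `p = π (exp X)` with `‖X‖` controlled by the chart distance
(`exists_lieExp_eq_norm_le`). Small `X` lie in `V`, where `log (exp X) = X`, so `ρ p ≤ ‖X‖` in the
induced seminorm. Strict differentiability of `exp` at `0` comes from a Gronwall estimate for an
equation with parameter (`exists_timeOneMap_hasStrictFDerivAt`). -/

/-! ### Riemannian distance versus chart distance. -/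

section RiemannianLowerBound

open MeasureTheory
open scoped NNReal ENNReal

variable {E : Type*} [NormedAddCommGroup E] [NormedSpace ℝ E]
  {M : Type*} [TopologicalSpace M] [ChartedSpace E M]
  [RiemannianBundle (fun x : M => TangentSpace 𝓘(ℝ, E) x)] [IsManifold 𝓘(ℝ, E) 1 M]

attribute [local instance] normedAddCommGroupTangentSpaceVectorSpace
  normedSpaceTangentSpaceVectorSpace

/-- A curve staying in a region where the differential of the chart is bounded by `C` moves in the
chart by at most `C` times its length. -/
theorem edist_extChartAt_le_pathELength {x : M} {C : ℝ≥0} {γ : ℝ → M}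
    (hγ : ContMDiff 𝓘(ℝ) 𝓘(ℝ, E) 1 γ)
    (hsource : ∀ t ∈ Icc (0 : ℝ) 1, γ t ∈ (chartAt E x).source)
    (hC : ∀ t ∈ Icc (0 : ℝ) 1, ∀ v, ‖mfderiv% (extChartAt 𝓘(ℝ, E) x) (γ t) v‖ₑ ≤ C * ‖v‖ₑ) :
    edist (extChartAt 𝓘(ℝ, E) x (γ 0)) (extChartAt 𝓘(ℝ, E) x (γ 1)) ≤
      C * pathELength 𝓘(ℝ, E) γ 0 1 := by
  have hsmooth : ContMDiffOn 𝓘(ℝ) 𝓘(ℝ, E) 1 (extChartAt 𝓘(ℝ, E) x ∘ γ) (Icc 0 1) :=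
    contMDiffOn_extChartAt.comp (I' := 𝓘(ℝ, E)) (t := (chartAt E x).source)
      hγ.contMDiffOn (fun t ht => hsource t ht)
  have hdiff : ∀ t ∈ Icc (0 : ℝ) 1, mfderiv[Icc 0 1] (extChartAt 𝓘(ℝ, E) x ∘ γ) t 1 =
      mfderiv% (extChartAt 𝓘(ℝ, E) x) (γ t) (mfderiv[Icc 0 1] γ t 1) := by
    intro t ht
    have h := mfderiv_comp_mfderivWithin (I := 𝓘(ℝ)) (I' := 𝓘(ℝ, E)) (I'' := 𝓘(ℝ, E))
      (s := Icc (0 : ℝ) 1) t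
      (mdifferentiableAt_extChartAt (I := 𝓘(ℝ, E)) (hsource t ht))
      ((hγ.mdifferentiable one_ne_zero).mdifferentiableOn _ ht)
      (uniqueMDiffWithinAt_iff_uniqueDiffWithinAt.2 (uniqueDiffOn_Icc zero_lt_one _ ht))
    exact congr($h 1)
  rw [edist_comm, edist_eq_enorm_sub]
  calc
    _ ≤ ∫⁻ t in Icc (0 : ℝ) 1, ‖derivWithin (extChartAt 𝓘(ℝ, E) x ∘ γ) (Icc 0 1) t‖ₑ :=
      enorm_sub_le_lintegral_derivWithin_Icc_of_contDiffOn_Icc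
        (contMDiffOn_iff_contDiffOn.1 hsmooth) zero_le_one
    _ = ∫⁻ t in Icc (0 : ℝ) 1, ‖mfderiv[Icc 0 1] (extChartAt 𝓘(ℝ, E) x ∘ γ) t 1‖ₑ := by
      simp_rw [← fderivWithin_derivWithin, mfderivWithin_eq_fderivWithin]
      rfl
    _ ≤ ∫⁻ t in Icc (0 : ℝ) 1, C * ‖mfderiv[Icc 0 1] γ t 1‖ₑ := by
      refine setLIntegral_mono' measurableSet_Icc fun t ht => ?_
      rw [hdiff t ht]
      exact hC t ht _
    _ = C * pathELength 𝓘(ℝ, E) γ 0 1 := by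
      rw [lintegral_const_mul' _ _ ENNReal.coe_ne_top,
        pathELength_eq_lintegral_mfderivWithin_Icc]

/-- Near a point, the distance measured in the chart is bounded by a multiple of the Riemannian
distance. -/
theorem eventually_edist_extChartAt_le_riemannianEDist [RegularSpace M]
    [IsContinuousRiemannianBundle E (fun x : M => TangentSpace 𝓘(ℝ, E) x)] (x : M) :
    ∃ C > (0 : ℝ≥0), ∀ᶠ y in 𝓝 x,
      edist (extChartAt 𝓘(ℝ, E) x x) (extChartAt 𝓘(ℝ, E) x y) ≤
        C * riemannianEDist 𝓘(ℝ, E) x y := by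
  obtain ⟨C, C_pos, hC⟩ := eventually_enorm_mfderiv_extChartAt_lt 𝓘(ℝ, E) x
  have hC' : {z : M | ∀ v, ‖mfderiv% (extChartAt 𝓘(ℝ, E) x) z v‖ₑ ≤ C * ‖v‖ₑ} ∈ 𝓝 x :=
    hC.mono fun z hz v => (ContinuousLinearMap.le_opENorm _ v).trans (mul_le_mul_left hz.le _)
  obtain ⟨c, c_pos, hc⟩ := setOfPred_riemannianEDist_lt_subset_nhds' 𝓘(ℝ, E)
    (Filter.inter_mem hC' (chart_source_mem_nhds E x))
  refine ⟨C, C_pos, ?_⟩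
  filter_upwards [eventually_riemannianEDist_lt 𝓘(ℝ, E) x c_pos] with y hy
  rw [← ENNReal.div_le_iff' (by simpa using C_pos.ne') ENNReal.coe_ne_top]
  refine le_of_forall_gt fun r hr => ?_
  -- Length below `c` confines the whole curve to the region where the chart differential is
  -- bounded; length below `r` gives the estimate.
  obtain ⟨γ, hγx, hγy, hγ, hlen, -⟩ :=
    exists_lt_locally_constant_of_riemannianEDist_lt (lt_min hr hy) zero_lt_one
  have hmem : ∀ t ∈ Icc (0 : ℝ) 1, γ t ∈ {z | ∀ v,
      ‖mfderiv% (extChartAt 𝓘(ℝ, E) x) z v‖ₑ ≤ C * ‖v‖ₑ} ∩ (chartAt E x).source := by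
    intro t ht
    refine hc (lt_of_le_of_lt ?_ (hlen.trans_le (min_le_right _ _)))
    exact (riemannianEDist_le_pathELength hγ.contMDiffOn hγx rfl ht.1).trans
      (pathELength_mono le_rfl ht.2)
  have h := edist_extChartAt_le_pathELength hγ (fun t ht => (hmem t ht).2)
    (fun t ht => (hmem t ht).1)
  rw [hγx, hγy] at h
  refine lt_of_le_of_lt ?_ (hlen.trans_le (min_le_left _ _))
  rwa [ENNReal.div_le_iff' (by simpa using C_pos.ne') ENNReal.coe_ne_top]

end RiemannianLowerBound

/-! ### Dependence of solutions of `c' = F(c) X` on the parameter `X`. -/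

section ParametricODE

open Metric
open scoped NNReal

/-- The Picard-Lindelöf theorem for a time-independent field, on a symmetric interval, with control
of the range of the solution. -/
theorem exists_solution_mem_closedBall {E : Type*} [NormedAddCommGroup E] [NormedSpace ℝ E]
    [CompleteSpace E] {f : E → E} {x₀ : E} {a L K : ℝ≥0} {T : ℝ} (hT : 0 ≤ T)
    (hb : ∀ x ∈ closedBall x₀ a, ‖f x‖ ≤ L) (hl : LipschitzOnWith K f (closedBall x₀ a))
    (hm : L * T ≤ a) :
    ∃ c : ℝ → E, c 0 = x₀ ∧ (∀ t, c t ∈ closedBall x₀ a) ∧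
      ∀ t ∈ Ioo (-T) T, HasDerivAt c (f (c t)) t := by
  have h0 : (0 : ℝ) ∈ Icc (-T) T := ⟨by linarith, hT⟩
  have hf : IsPicardLindelof (fun _ => f) (⟨0, h0⟩ : Icc (-T) T) x₀ a 0 L K :=
    .of_time_independent hb hl (by simpa using hm)
  have hx : x₀ ∈ closedBall x₀ ((0 : ℝ≥0) : ℝ) := by simp
  obtain ⟨α, hα⟩ := ODE.FunSpace.exists_isFixedPt_next hf hx
  have key := (ODE.FunSpace.isFixedPt_next_iff hf hx).1 hα
  refine ⟨α.compProj, ?_, fun t => α.compProj_mem_closedBall hf.mul_max_le, fun t ht => ?_⟩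
  · have := key ⟨0, h0⟩
    rw [ODE.FunSpace.compProj_of_mem h0, this]
    simp
  · refine ((ODE.hasDerivWithinAt_picard_Icc h0 hf.continuousOn_uncurry
      α.continuous_compProj.continuousOn (fun _ _ => α.compProj_mem_closedBall hf.mul_max_le)
      x₀ (Ioo_subset_Icc_self ht)).congr_of_mem (fun s hs => ?_)
      (Ioo_subset_Icc_self ht)).hasDerivAt (Icc_mem_nhds ht.1 ht.2)
    rw [ODE.FunSpace.compProj_of_mem hs, key ⟨s, hs⟩]

variable {E : Type*} [NormedAddCommGroup E] [NormedSpace ℝ E]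
  {P : Type*} [NormedAddCommGroup P] [NormedSpace ℝ P]

/-- Two solutions of `c' = F(c) X` with the same start and parameters `X`, `Y`: the difference of
the endpoints is approximated by `F(x₀) (X - Y)`. -/
theorem norm_solution_sub_solution_sub_le {F : E → P →L[ℝ] E} {x₀ : E} {s : Set E} {K M : ℝ}
    {X Y : P} {c d : ℝ → E} (hK : 0 ≤ K)
    (hl : ∀ x ∈ s, ∀ y ∈ s, ‖F x - F y‖ ≤ K * ‖x - y‖) (hM : ∀ x ∈ s, ‖F x‖ ≤ M) (hx₀ : x₀ ∈ s)
    (hc0 : c 0 = x₀) (hd0 : d 0 = x₀) (hX : K * ‖X‖ ≤ 1)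
    (hc : ∀ t ∈ Icc (0 : ℝ) 1, HasDerivAt c (F (c t) X) t ∧ c t ∈ s)
    (hd : ∀ t ∈ Icc (0 : ℝ) 1, HasDerivAt d (F (d t) Y) t ∧ d t ∈ s) {b : ℝ}
    (hb : ∀ t ∈ Icc (0 : ℝ) 1, ‖d t - x₀‖ ≤ b) :
    ‖c 1 - d 1 - F x₀ (X - Y)‖ ≤ K * (2 * M * ‖X‖ + b) * ‖X - Y‖ := by
  have hM0 : 0 ≤ M := (norm_nonneg _).trans (hM x₀ hx₀)
  have hderiv : ∀ t ∈ Icc (0 : ℝ) 1,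
      HasDerivAt (fun t => c t - d t) (F (c t) X - F (d t) Y) t :=
    fun t ht => (hc t ht).1.sub (hd t ht).1
  have hsplit : ∀ t, F (c t) X - F (d t) Y = (F (c t) - F (d t)) X + F (d t) (X - Y) := by
    intro t; simp
  have hgron : ∀ t ∈ Icc (0 : ℝ) 1, ‖c t - d t‖ ≤ 2 * M * ‖X - Y‖ := by
    -- As `K * ‖X‖ ≤ 1`, the difference satisfies `‖(c - d)'‖ ≤ ‖c - d‖ + M * ‖X - Y‖`; Gronwall
    -- yields the factor `exp t - 1 ≤ 2`.
    intro t ht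
    have h := norm_le_gronwallBound_of_norm_deriv_right_le (f := fun t => c t - d t)
      (f' := fun t => F (c t) X - F (d t) Y) (δ := 0) (K := 1) (ε := M * ‖X - Y‖)
      (a := 0) (b := 1)
      (fun t ht => (hderiv t ht).continuousAt.continuousWithinAt)
      (fun t ht => (hderiv t (Ico_subset_Icc_self ht)).hasDerivWithinAt)
      (by simp [hc0, hd0]) (fun t ht => ?_) t ht
    · refine h.trans ?_
      rw [gronwallBound_of_K_ne_0 one_ne_zero]
      have h1 : Real.exp (1 * (t - 0)) - 1 ≤ 2 := by
        have : Real.exp (1 * (t - 0)) ≤ Real.exp 1 := Real.exp_le_exp.2 (by linarith [ht.2])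
        linarith [Real.exp_one_lt_d9]
      have h2 : 0 ≤ M * ‖X - Y‖ := by positivity
      have := mul_le_mul_of_nonneg_left h1 h2
      simp only [zero_mul, div_one, zero_add]
      linarith
    · have ht' := Ico_subset_Icc_self ht
      rw [hsplit]
      refine (norm_add_le _ _).trans (add_le_add ?_ ?_)
      · refine ((F (c t) - F (d t)).le_opNorm X).trans ?_
        calc _ ≤ K * ‖c t - d t‖ * ‖X‖ := by
              gcongr; exact hl _ (hc t ht').2 _ (hd t ht').2
          _ = K * ‖X‖ * ‖c t - d t‖ := by ring
          _ ≤ 1 * ‖c t - d t‖ := by gcongr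
      · exact ((F (d t)).le_opNorm _).trans (by gcongr; exact hM _ (hd t ht').2)
  have hW : ∀ t ∈ Icc (0 : ℝ) 1, HasDerivWithinAt (fun t => c t - d t - t • F x₀ (X - Y))
      (F (c t) X - F (d t) Y - F x₀ (X - Y)) (Icc 0 1) t := by
    intro t ht
    have := ((hderiv t ht).sub ((hasDerivAt_id t).smul_const (F x₀ (X - Y)))).hasDerivWithinAt
      (s := Icc (0 : ℝ) 1)
    rw [one_smul] at this
    exact this
  have := norm_image_sub_le_of_norm_deriv_le_segment_01' hW
    (C := K * (2 * M * ‖X‖ + b) * ‖X - Y‖) (fun t ht => ?_)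
  · simpa [hc0, hd0] using this
  · have ht' := Ico_subset_Icc_self ht
    have : F (c t) X - F (d t) Y - F x₀ (X - Y) =
        (F (c t) - F (d t)) X + (F (d t) - F x₀) (X - Y) := by
      rw [hsplit]; simp only [_root_.sub_apply]; abel
    rw [this]
    calc _ ≤ ‖F (c t) - F (d t)‖ * ‖X‖ + ‖F (d t) - F x₀‖ * ‖X - Y‖ :=
          (norm_add_le _ _).trans (add_le_add (ContinuousLinearMap.le_opNorm _ _)
            (ContinuousLinearMap.le_opNorm _ _))
      _ ≤ K * (2 * M * ‖X - Y‖) * ‖X‖ + K * b * ‖X - Y‖ := by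
          gcongr
          · exact (hl _ (hc t ht').2 _ (hd t ht').2).trans (by gcongr; exact hgron t ht')
          · exact (hl _ (hd t ht').2 _ hx₀).trans (by gcongr; exact hb t ht')
      _ = _ := by ring

/-- The time-one map of the family of equations `c' = F(c) X`, `c(0) = x₀`, is defined for small
parameters `X` and strictly differentiable at `X = 0` with derivative `F(x₀)`. -/
theorem exists_timeOneMap_hasStrictFDerivAt [CompleteSpace E] {F : E → P →L[ℝ] E} {x₀ : E}
    (hF : ContDiffAt ℝ 1 F x₀) {U : Set E} (hU : U ∈ 𝓝 x₀) :
    ∃ e : P → E, e 0 = x₀ ∧ HasStrictFDerivAt e (F x₀) 0 ∧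
      ∀ᶠ X in 𝓝 (0 : P), ∃ c : ℝ → E, c 0 = x₀ ∧ c 1 = e X ∧
        ∀ t ∈ Ioo (-2 : ℝ) 2, HasDerivAt c (F (c t) X) t ∧ c t ∈ U := by
  obtain ⟨K, s, hs, hK⟩ := hF.exists_lipschitzOnWith
  set M : ℝ≥0 := ‖F x₀‖₊ + 1 with hMdef
  have hMs : ∀ᶠ x in 𝓝 x₀, ‖F x‖ < M :=
    hF.continuousAt.norm.eventually_lt_const (by simp [hMdef])
  obtain ⟨a, a_pos, ha⟩ := Metric.nhds_basis_closedBall.mem_iff.1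
    (Filter.inter_mem (Filter.inter_mem hs hMs) hU)
  have hM0 : (0 : ℝ) < M := by rw [hMdef]; positivity
  have hlip : ∀ x ∈ closedBall x₀ a, ∀ y ∈ closedBall x₀ a, ‖F x - F y‖ ≤ K * ‖x - y‖ := by
    intro x hx y hy
    simpa [dist_eq_norm] using hK.dist_le_mul x (ha hx).1.1 y (ha hy).1.1
  have hM : ∀ x ∈ closedBall x₀ a, ‖F x‖ ≤ M := fun x hx => (ha hx).1.2.le
  have hx₀ : x₀ ∈ closedBall x₀ a := mem_closedBall_self a_pos.le
  -- The first bound keeps solutions in the ball up to time `2`, the second gives `K * ‖X‖ ≤ 1` for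
  -- Gronwall.
  set δ : ℝ := min (a / (2 * M)) (1 / (K + 1)) with hδdef
  have hδ : 0 < δ := lt_min (by positivity) (by positivity)
  have hsol : ∀ X : P, ∃ c : ℝ → E, ‖X‖ < δ → c 0 = x₀ ∧
      (∀ t, ‖c t - x₀‖ ≤ 2 * M * ‖X‖ ∧ c t ∈ closedBall x₀ a) ∧
      ∀ t ∈ Ioo (-2 : ℝ) 2, HasDerivAt c (F (c t) X) t := by
    intro X
    by_cases hX : ‖X‖ < δ
    · have hle : 2 * M * ‖X‖ ≤ a := by
        have := hX.le.trans (min_le_left _ _)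
        rw [le_div_iff₀ (by positivity)] at this
        linarith
      have hsub : closedBall x₀ ((2 * M * ‖X‖₊ : ℝ≥0) : ℝ) ⊆ closedBall x₀ a :=
        closedBall_subset_closedBall (by simpa using hle)
      obtain ⟨c, h0, hmem, hc⟩ := exists_solution_mem_closedBall (f := fun x => F x X) (x₀ := x₀)
        (a := 2 * M * ‖X‖₊) (L := M * ‖X‖₊) (K := K * ‖X‖₊) (T := 2) zero_le_two
        (fun x hx => by
          simpa using ((F x).le_opNorm X).trans
            (mul_le_mul_of_nonneg_right (hM x (hsub hx)) (norm_nonneg X)))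
        (LipschitzOnWith.of_dist_le_mul fun x hx y hy => by
          have h1 := (F x - F y).le_opNorm X
          have h2 := mul_le_mul_of_nonneg_right (hlip x (hsub hx) y (hsub hy)) (norm_nonneg X)
          rw [dist_eq_norm, dist_eq_norm]
          simp only [_root_.sub_apply] at h1
          push_cast
          linarith)
        (by push_cast; linarith)
      refine ⟨c, fun _ => ⟨h0, fun t => ⟨?_, hsub (hmem t)⟩, hc⟩⟩
      simpa [dist_eq_norm] using hmem t
    · exact ⟨fun _ => 0, fun h => absurd h hX⟩
  choose c hc using hsol
  have hsmall : ∀ᶠ X in 𝓝 (0 : P), ‖X‖ < δ :=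
    (continuous_norm.tendsto' (0 : P) 0 norm_zero).eventually_lt_const hδ
  refine ⟨fun X => c X 1, ?_, ?_, ?_⟩
  · have := ((hc 0 (by simpa using hδ)).2.1 1).1
    simpa [sub_eq_zero] using this
  -- Apply the comparison lemma with `b = 2 * M * ‖Y‖`: the factor in front of `‖X - Y‖` tends to
  -- `0` with `(X, Y)`.
  · refine .of_isLittleO ?_
    rw [Asymptotics.isLittleO_iff]
    intro ε hε
    have hcont : Tendsto (fun p : P × P => (K : ℝ) * (2 * M * ‖p.1‖ + 2 * M * ‖p.2‖))
        (𝓝 (0, 0)) (𝓝 0) := by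
      have : Continuous (fun p : P × P => (K : ℝ) * (2 * M * ‖p.1‖ + 2 * M * ‖p.2‖)) := by
        fun_prop
      simpa using this.tendsto (0, 0)
    have h2 : ∀ᶠ p in 𝓝 ((0 : P), (0 : P)), ‖p.1‖ < δ ∧ ‖p.2‖ < δ :=
      (continuous_fst.tendsto' (0, 0) 0 rfl |>.eventually hsmall).and
        (continuous_snd.tendsto' (0, 0) 0 rfl |>.eventually hsmall)
    filter_upwards [hcont.eventually_le_const hε, h2] with p hp hp2
    obtain ⟨h10, h1b, h1d⟩ := hc p.1 hp2.1
    obtain ⟨h20, h2b, h2d⟩ := hc p.2 hp2.2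
    have hI : ∀ t ∈ Icc (0 : ℝ) 1, t ∈ Ioo (-2 : ℝ) 2 :=
      fun t ht => ⟨by linarith [ht.1], by linarith [ht.2]⟩
    refine (norm_solution_sub_solution_sub_le (s := closedBall x₀ a) K.2 hlip hM hx₀ h10 h20 ?_
      (fun t ht => ⟨h1d t (hI t ht), (h1b t).2⟩) (fun t ht => ⟨h2d t (hI t ht), (h2b t).2⟩)
      (fun t _ => (h2b t).1)).trans (mul_le_mul_of_nonneg_right hp (norm_nonneg _))
    have := hp2.1.le.trans (min_le_right _ _)
    rw [le_div_iff₀ (by positivity)] at this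
    have := norm_nonneg p.1
    change (K : ℝ) * ‖p.1‖ ≤ 1
    nlinarith
  · filter_upwards [hsmall] with X hX
    obtain ⟨h0, hb, hd⟩ := hc X hX
    exact ⟨c X, h0, rfl, fun t ht => ⟨hd t ht, (ha (hb t).2).2⟩⟩

end ParametricODE

/-- A family of continuous linear maps on a finite-dimensional space is `C^n` at a point if all its
applications are. -/
theorem contDiffAt_of_forall_clm_apply {𝕜 : Type*} [NontriviallyNormedField 𝕜] [CompleteSpace 𝕜]
    {D : Type*} [NormedAddCommGroup D] [NormedSpace 𝕜 D]
    {E : Type*} [NormedAddCommGroup E] [NormedSpace 𝕜 E] [FiniteDimensional 𝕜 E]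
    {F : Type*} [NormedAddCommGroup F] [NormedSpace 𝕜 F] {n : WithTop ℕ∞}
    {f : D → E →L[𝕜] F} {x : D} (h : ∀ y, ContDiffAt 𝕜 n (fun x => f x y) x) :
    ContDiffAt 𝕜 n f x := by
  have hd : Module.finrank 𝕜 E = Module.finrank 𝕜 (Fin (Module.finrank 𝕜 E) → 𝕜) :=
    (Module.finrank_fin_fun 𝕜).symm
  let e₁ := ContinuousLinearEquiv.ofFinrankEq hd
  let e₂ := (e₁.arrowCongr (1 : F ≃L[𝕜] F)).trans
    (ContinuousLinearEquiv.piRing (Fin (Module.finrank 𝕜 E)))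
  rw [← Function.id_comp f, ← e₂.symm_comp_self]
  exact e₂.symm.contDiff.contDiffAt.comp x (contDiffAt_pi.mpr fun i => h _)

/-! ### The exponential of a Lie group and its derivative at `0`. -/

section LieExponentialCalculus

variable {E : Type*} [NormedAddCommGroup E] [NormedSpace ℝ E]
  {G : Type*} [TopologicalSpace G] [ChartedSpace E G] [Group G] [LieGroup 𝓘(ℝ, E) ∞ G]

theorem contMDiff_one_mulInvariantVectorField (X : GroupLieAlgebra 𝓘(ℝ, E) G) :
    ContMDiff 𝓘(ℝ, E) 𝓘(ℝ, E).tangent 1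
      (fun g : G => (⟨g, mulInvariantVectorField X g⟩ : TangentBundle 𝓘(ℝ, E) G)) := by
  have : LieGroup 𝓘(ℝ, E) (minSmoothness ℝ 3) G :=
    LieGroup.of_le (n := ∞)
      (by simp only [minSmoothness_of_isRCLikeNormedField]; exact ENat.LEInfty.out)
  exact (contMDiff_mulInvariantVectorField X).of_le
    (by simp only [minSmoothness_of_isRCLikeNormedField]; exact one_le_two)

theorem mdifferentiable_mul_left' (g : G) :
    MDifferentiable 𝓘(ℝ, E) 𝓘(ℝ, E) (fun h : G => g * h) :=
  (contMDiff_mul_left (I := 𝓘(ℝ, E)) (n := ∞)).mdifferentiable (by simp)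

/-- Left translations preserve left-invariant vector fields. -/
theorem mfderiv_mul_left_mulInvariantVectorField (X : GroupLieAlgebra 𝓘(ℝ, E) G) (g h : G) :
    mfderiv 𝓘(ℝ, E) 𝓘(ℝ, E) (fun x : G => g * x) h (mulInvariantVectorField X h) =
      mulInvariantVectorField X (g * h) := by
  have hcomp : (fun x : G => g * h * x) = (fun x => g * x) ∘ (fun x => h * x) := by
    ext x; simp [mul_assoc]
  symm
  rw [mulInvariantVectorField, hcomp]
  exact mfderiv_comp_apply_of_eq _ (mdifferentiable_mul_left' g h) (mdifferentiable_mul_left' h 1)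
    (mul_one h) X

theorem IsMIntegralCurveOn.mul_left {X : GroupLieAlgebra 𝓘(ℝ, E) G} {γ : ℝ → G} {s : Set ℝ}
    (hγ : IsMIntegralCurveOn (I := 𝓘(ℝ, E)) γ (mulInvariantVectorField X) s) (g : G) :
    IsMIntegralCurveOn (I := 𝓘(ℝ, E)) (fun t => g * γ t) (mulInvariantVectorField X) s := by
  intro t ht
  have h := ((mdifferentiable_mul_left' (E := E) g (γ t)).hasMFDerivAt.comp_hasMFDerivWithinAt t
    (hγ t ht))
  have heq : (mfderiv 𝓘(ℝ, E) 𝓘(ℝ, E) (fun x : G => g * x) (γ t)).comp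
      ((1 : ℝ →L[ℝ] ℝ).smulRight (mulInvariantVectorField X (γ t))) =
      (1 : ℝ →L[ℝ] ℝ).smulRight (mulInvariantVectorField X (g * γ t)) := by
    rw [← mfderiv_mul_left_mulInvariantVectorField]
    ext
    simp
  exact h.congr_mfderiv heq

variable [T2Space G] [CompleteSpace E]

/-- Left-invariant vector fields are complete. -/
theorem exists_isMIntegralCurve_mulInvariantVectorField (X : GroupLieAlgebra 𝓘(ℝ, E) G) :
    ∃ γ : ℝ → G, γ 0 = 1 ∧ IsMIntegralCurve (I := 𝓘(ℝ, E)) γ (mulInvariantVectorField X) := by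
  have : IsManifold 𝓘(ℝ, E) 1 G := IsManifold.of_le (n := ∞) (by exact_mod_cast le_top)
  have hv := contMDiff_one_mulInvariantVectorField (E := E) X
  obtain ⟨γ, h0, hγ⟩ := exists_isMIntegralCurveAt_of_contMDiffAt_boundaryless 0
    (hv.contMDiffAt (x := (1 : G)))
  obtain ⟨ε, hε, hγ⟩ := isMIntegralCurveAt_iff'.1 hγ
  -- Left translates of the curve through `1` give solutions through every point with the same
  -- lifetime `ε`, which forces completeness.
  refine exists_isMIntegralCurve_of_isMIntegralCurveOn hv hε (fun g => ⟨fun t => g * γ t, ?_, ?_⟩) 1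
  · simp [h0]
  · have := hγ.mul_left g
    rwa [Real.ball_eq_Ioo, zero_sub, zero_add] at this

theorem exists_isMIntegralCurve_lieExp (X : GroupLieAlgebra 𝓘(ℝ, E) G) :
    ∃ γ : ℝ → G, γ 0 = 1 ∧ γ 1 = lieExp X ∧
      IsMIntegralCurve (I := 𝓘(ℝ, E)) γ (mulInvariantVectorField X) := by
  have h := exists_isMIntegralCurve_mulInvariantVectorField (E := E) X
  exact ⟨h.choose, h.choose_spec.1, by rw [lieExp, dif_pos h], h.choose_spec.2⟩

/-- The exponential is computed by any integral curve defined up to time one. -/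
theorem lieExp_eq_of_isMIntegralCurveOn {X : GroupLieAlgebra 𝓘(ℝ, E) G} {γ : ℝ → G}
    (h0 : γ 0 = 1)
    (hγ : IsMIntegralCurveOn (I := 𝓘(ℝ, E)) γ (mulInvariantVectorField X) (Ioo (-2) 2)) :
    lieExp X = γ 1 := by
  have : IsManifold 𝓘(ℝ, E) 1 G := IsManifold.of_le (n := ∞) (by exact_mod_cast le_top)
  obtain ⟨η, η0, η1, hη⟩ := exists_isMIntegralCurve_lieExp X
  rw [← η1]
  exact isMIntegralCurveOn_Ioo_eqOn_of_contMDiff_boundaryless (t₀ := 0) (by norm_num)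
    (contMDiff_one_mulInvariantVectorField X) (hη.isMIntegralCurveOn _) hγ (by rw [η0, h0])
    (by norm_num)

variable (E G) in
/-- The left-invariant vector fields in the preferred chart at the identity: at the point `x` of the
chart, the linear map sending `X ∈ T_e G` to the value of its left-invariant vector field. -/
noncomputable def invariantFieldInChart (x : E) : E →L[ℝ] E :=
  (tangentCoordChange 𝓘(ℝ, E) ((extChartAt 𝓘(ℝ, E) (1 : G)).symm x) (1 : G)
    ((extChartAt 𝓘(ℝ, E) (1 : G)).symm x)).comp
    (mfderiv 𝓘(ℝ, E) 𝓘(ℝ, E) (fun h : G => (extChartAt 𝓘(ℝ, E) (1 : G)).symm x * h) 1 : E →L[ℝ] E)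

omit [T2Space G] [CompleteSpace E] in
-- In finite dimension it suffices to fix `X`; the result is then the chart expression of a
-- left-invariant vector field, already known to be `C^1`.
theorem contDiffAt_invariantFieldInChart [FiniteDimensional ℝ E] :
    ContDiffAt ℝ 1 (invariantFieldInChart E G) (extChartAt 𝓘(ℝ, E) (1 : G) 1) := by
  have : IsManifold 𝓘(ℝ, E) 1 G := IsManifold.of_le (n := ∞) (by exact_mod_cast le_top)
  refine contDiffAt_of_forall_clm_apply fun X => ?_
  have h := contMDiff_one_mulInvariantVectorField (E := E) (G := G) X |>.contMDiffAt (x := 1)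
  rw [contMDiffAt_iff] at h
  have h2 := h.2.snd
  rw [ModelWithCorners.range_eq_univ, contDiffWithinAt_univ] at h2
  exact h2

omit [T2Space G] [CompleteSpace E] in
theorem invariantFieldInChart_one :
    invariantFieldInChart E G (extChartAt 𝓘(ℝ, E) (1 : G) 1) = ContinuousLinearMap.id ℝ E := by
  have hone : (extChartAt 𝓘(ℝ, E) (1 : G)).symm (extChartAt 𝓘(ℝ, E) (1 : G) 1) = 1 :=
    extChartAt_to_inv (1 : G)
  have hid : (fun h : G => (1 : G) * h) = id := by ext h; simp
  have hd : (mfderiv 𝓘(ℝ, E) 𝓘(ℝ, E) (fun h : G => (1 : G) * h) 1 : E →L[ℝ] E) =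
      ContinuousLinearMap.id ℝ E := by
    rw [hid]; exact mfderiv_id
  ext X
  rw [invariantFieldInChart, hone, hd]
  exact tangentCoordChange_self (mem_extChartAt_source (1 : G))

omit [T2Space G] [CompleteSpace E] in
-- Tangent vectors at `g` are read in the preferred chart of `g`, while `c` solves the equation in
-- the chart of `1`. The coordinate change from `1` to `g` cancels the one built into
-- `invariantFieldInChart`.
theorem hasMFDerivAt_symm_of_hasDerivAt {X : GroupLieAlgebra 𝓘(ℝ, E) G} {c : ℝ → E} {t : ℝ}
    (hc : HasDerivAt c (invariantFieldInChart E G (c t) X) t)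
    (ht : c t ∈ (extChartAt 𝓘(ℝ, E) (1 : G)).target) :
    HasMFDerivAt 𝓘(ℝ) 𝓘(ℝ, E) (fun s => (extChartAt 𝓘(ℝ, E) (1 : G)).symm (c s)) t
      ((1 : ℝ →L[ℝ] ℝ).smulRight
        (mulInvariantVectorField X ((extChartAt 𝓘(ℝ, E) (1 : G)).symm (c t)))) := by
  have : IsManifold 𝓘(ℝ, E) 1 G := IsManifold.of_le (n := ∞) (by exact_mod_cast le_top)
  set g : G := (extChartAt 𝓘(ℝ, E) (1 : G)).symm (c t) with hg
  have h1 : g ∈ (extChartAt 𝓘(ℝ, E) (1 : G)).source := (extChartAt 𝓘(ℝ, E) (1 : G)).map_target ht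
  have h2 : g ∈ (extChartAt 𝓘(ℝ, E) g).source := mem_extChartAt_source g
  have hgt : extChartAt 𝓘(ℝ, E) (1 : G) g = c t := (extChartAt 𝓘(ℝ, E) (1 : G)).right_inv ht
  let v : E := mulInvariantVectorField X g
  have hv : tangentCoordChange 𝓘(ℝ, E) (1 : G) g g (tangentCoordChange 𝓘(ℝ, E) g (1 : G) g v) =
      v := by
    rw [tangentCoordChange_comp ⟨⟨h2, h1⟩, h2⟩, tangentCoordChange_self h2]
  have h := hasFDerivWithinAt_tangentCoordChange (I := 𝓘(ℝ, E)) ⟨h1, h2⟩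
  rw [hgt, ModelWithCorners.range_eq_univ, hasFDerivWithinAt_univ] at h
  have hd : HasDerivAt ((extChartAt 𝓘(ℝ, E) g ∘ (extChartAt 𝓘(ℝ, E) (1 : G)).symm) ∘ c)
      (tangentCoordChange 𝓘(ℝ, E) (1 : G) g g (tangentCoordChange 𝓘(ℝ, E) g (1 : G) g v)) t :=
    h.comp_hasDerivAt t hc
  rw [hv] at hd
  have hf : HasFDerivAt ((extChartAt 𝓘(ℝ, E) g ∘ (extChartAt 𝓘(ℝ, E) (1 : G)).symm) ∘ c)
      ((1 : ℝ →L[ℝ] ℝ).smulRight v) t :=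
    hd.hasFDerivAt.congr_fderiv (by ext; simp)
  exact ⟨(continuousAt_extChartAt_symm'' ht).comp hc.continuousAt, hf.hasFDerivWithinAt⟩

/-- In the preferred chart at the identity, the exponential is strictly differentiable at `0`, its
derivative being the identity. -/
theorem exists_lieExp_eq_symm_hasStrictFDerivAt [FiniteDimensional ℝ E] :
    ∃ e : E → E, e 0 = extChartAt 𝓘(ℝ, E) (1 : G) 1 ∧
      HasStrictFDerivAt e (ContinuousLinearMap.id ℝ E) 0 ∧
      ∀ᶠ X in 𝓝 (0 : E), lieExp (G := G) (E := E) X = (extChartAt 𝓘(ℝ, E) (1 : G)).symm (e X) := by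
  obtain ⟨e, he0, he, hc⟩ := exists_timeOneMap_hasStrictFDerivAt
    (contDiffAt_invariantFieldInChart (E := E) (G := G)) (extChartAt_target_mem_nhds (1 : G))
  rw [invariantFieldInChart_one] at he
  refine ⟨e, he0, he, hc.mono fun X ⟨c, c0, c1, hc⟩ => ?_⟩
  rw [← c1]
  refine lieExp_eq_of_isMIntegralCurveOn
    (γ := fun s => (extChartAt 𝓘(ℝ, E) (1 : G)).symm (c s)) (by simp [c0]) fun t ht => ?_
  exact (hasMFDerivAt_symm_of_hasDerivAt (hc t ht).1 (hc t ht).2).hasMFDerivWithinAt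

end LieExponentialCalculus

/-! ### Submersions and regularity of integral curves. -/

section SubmersionAndCurves

variable {E : Type*} [NormedAddCommGroup E] [NormedSpace ℝ E]
  {F : Type*} [NormedAddCommGroup F] [NormedSpace ℝ F]
  {M : Type*} [TopologicalSpace M] [ChartedSpace E M]
  {N : Type*} [TopologicalSpace N] [ChartedSpace F N]

/-- The differential of a submersion is surjective. -/
theorem Manifold.IsSubmersionAtOfComplement.mfderiv_surjective
    [IsManifold 𝓘(ℝ, E) ∞ M]
    {F' : Type*} [NormedAddCommGroup F'] [NormedSpace ℝ F'] {f : M → N} {x : M}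
    (h : IsSubmersionAtOfComplement F' 𝓘(ℝ, E) 𝓘(ℝ, F) ∞ f x) :
    Function.Surjective (mfderiv 𝓘(ℝ, E) 𝓘(ℝ, F) f x) := by
  have hw := h.writtenInCharts
  simp only [mfld_simps] at hw
  set κ := h.domChart
  set l := h.codChart
  have hκ : x ∈ κ.source := h.mem_domChart_source
  have hl : f x ∈ l.source := h.mem_codChart_source
  have hlκ : l (f x) = (h.equiv (κ x)).1 := by
    have := hw (κ.map_source hκ)
    simpa [κ.left_inv hκ] using this
  -- In the charts `f` is a linear projection; the slice `j` through `κ x` gives a local section `s`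
  -- of `f`, whose differential is a right inverse.
  let j : F → E := fun y => h.equiv.symm (y, (h.equiv (κ x)).2)
  have hj : ContDiff ℝ ∞ j := by fun_prop
  have hjx : j (l (f x)) = κ x := by simp only [j, hlκ]; simp
  let s : N → M := fun q => κ.symm (j (l q))
  have hsx : s (f x) = x := by simp only [s, hjx, κ.left_inv hκ]
  have hs : MDifferentiableAt 𝓘(ℝ, F) 𝓘(ℝ, E) s (f x) := by
    have h1 : ContMDiffAt 𝓘(ℝ, F) 𝓘(ℝ, F) ∞ l (f x) :=
      contMDiffAt_of_mem_maximalAtlas h.codChart_mem_maximalAtlas hl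
    have h2 : ContMDiffAt 𝓘(ℝ, E) 𝓘(ℝ, E) ∞ κ.symm (j (l (f x))) := by
      rw [hjx]
      exact contMDiffAt_symm_of_mem_maximalAtlas h.domChart_mem_maximalAtlas (κ.map_source hκ)
    exact (h2.comp (f x) (hj.contMDiff.contMDiffAt.comp (f x) h1)).mdifferentiableAt (by simp)
  have hcont : ContinuousAt (fun q => j (l q)) (f x) :=
    hj.continuous.continuousAt.comp (l.continuousAt hl)
  have hfs : f ∘ s =ᶠ[𝓝 (f x)] id := by
    filter_upwards [l.open_source.mem_nhds hl,
      hcont.preimage_mem_nhds (κ.open_target.mem_nhds (by rw [hjx]; exact κ.map_source hκ))]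
      with q hq hjq
    have hjq : j (l q) ∈ κ.target := hjq
    refine l.injOn (h.source_subset_preimage_source (κ.map_target hjq)) hq ?_
    have := hw hjq
    simp only [Function.comp_apply] at this
    change l (f (κ.symm (j (l q)))) = l q
    rw [this]
    simp [j]
  have hf : MDifferentiableAt 𝓘(ℝ, E) 𝓘(ℝ, F) f x := h.contMDiffAt.mdifferentiableAt (by simp)
  intro w
  refine ⟨mfderiv 𝓘(ℝ, F) 𝓘(ℝ, E) s (f x) w, ?_⟩
  have h1 := mfderiv_comp_apply_of_eq (f x) hf hs hsx w
  rw [hfs.mfderiv_eq, mfderiv_id] at h1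
  exact h1.symm

/-- An integral curve of a `C^1` vector field is `C^1`. -/
theorem IsMIntegralCurve.contMDiff_one [IsManifold 𝓘(ℝ, E) 1 M]
    {v : (x : M) → TangentSpace 𝓘(ℝ, E) x}
    (hv : Continuous (fun x => (⟨x, v x⟩ : TangentBundle 𝓘(ℝ, E) M))) {γ : ℝ → M}
    (hγ : IsMIntegralCurve (I := 𝓘(ℝ, E)) γ v) : ContMDiff 𝓘(ℝ) 𝓘(ℝ, E) 1 γ := by
  intro t₀
  rw [contMDiffAt_iff]
  refine ⟨hγ.continuous.continuousAt, ?_⟩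
  rw [ModelWithCorners.range_eq_univ, contDiffWithinAt_univ]
  suffices h : ContDiffAt ℝ 1 (extChartAt 𝓘(ℝ, E) (γ t₀) ∘ γ) t₀ from h
  rw [contDiffAt_one_iff]
  let e := trivializationAt E (TangentSpace 𝓘(ℝ, E)) (γ t₀)
  have hopen : IsOpen (γ ⁻¹' e.baseSet) := e.open_baseSet.preimage hγ.continuous
  have ht₀ : t₀ ∈ γ ⁻¹' e.baseSet :=
    FiberBundle.mem_baseSet_trivializationAt E (TangentSpace 𝓘(ℝ, E)) (γ t₀)
  -- The chart derivative of `γ` is the trivialized value of `v` along `γ`, hence continuous.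
  have hcont : ContinuousOn (fun t => (e ⟨γ t, v (γ t)⟩).2) (γ ⁻¹' e.baseSet) := by
    refine continuous_snd.comp_continuousOn (e.continuousOn.comp
      (hv.comp hγ.continuous).continuousOn fun t ht => ?_)
    rw [e.source_eq]
    exact ht
  refine ⟨fun t => ContinuousLinearMap.toSpanSingleton ℝ (e ⟨γ t, v (γ t)⟩).2, _,
    Filter.inter_mem (hopen.mem_nhds ht₀) (hγ.isMIntegralCurveAt t₀).eventually_hasDerivAt,
    ?_, fun t ht => ?_⟩
  · have := ((ContinuousLinearMap.toSpanSingletonCLE (𝕜 := ℝ) (E := E)).continuous.comp_continuousOn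
      hcont).mono (inter_subset_left (t := {x | (fun t => HasDerivAt (extChartAt 𝓘(ℝ, E) (γ t₀) ∘ γ)
        (tangentCoordChange 𝓘(ℝ, E) (γ t) (γ t₀) (γ t) (v (γ t))) t) x}))
    exact this
  · exact HasDerivAt.hasFDerivAt ht.2

end SubmersionAndCurves

/-! ### Local surjectivity of `f ∘ exp` with a norm bound. -/

section LocalSurjectivity

variable {E : Type*} [NormedAddCommGroup E] [NormedSpace ℝ E] [FiniteDimensional ℝ E]
  {F : Type*} [NormedAddCommGroup F] [NormedSpace ℝ F] [FiniteDimensional ℝ F]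
  {G : Type*} [TopologicalSpace G] [ChartedSpace E G] [Group G] [LieGroup 𝓘(ℝ, E) ∞ G]
  [T2Space G]
  {N : Type*} [TopologicalSpace N] [ChartedSpace F N]

/-- If the differential of `f : G → N` at the identity is surjective, then every point `p` near
`f 1` is of the form `f (exp X)` with `X` small, its norm being controlled by the distance from
`f 1` to `p` in the chart. -/
theorem exists_lieExp_eq_norm_le {f : G → N}
    (hf : ContMDiffAt 𝓘(ℝ, E) 𝓘(ℝ, F) 1 f 1)
    (hsurj : Function.Surjective (mfderiv 𝓘(ℝ, E) 𝓘(ℝ, F) f 1)) :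
    ∃ C : ℝ, 0 ≤ C ∧ ∀ U ∈ 𝓝 (0 : E), ∀ᶠ p in 𝓝 (f 1), ∃ X ∈ U,
      f (lieExp (E := E) (G := G) X) = p ∧
      ‖X‖ ≤ C * ‖extChartAt 𝓘(ℝ, F) (f 1) p - extChartAt 𝓘(ℝ, F) (f 1) (f 1)‖ := by
  have : CompleteSpace E := FiniteDimensional.complete ℝ E
  have : CompleteSpace F := FiniteDimensional.complete ℝ F
  set φ := extChartAt 𝓘(ℝ, F) (f 1) with hφ
  set ψ := extChartAt 𝓘(ℝ, E) (1 : G) with hψ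
  obtain ⟨e, he0, he, hexp⟩ := exists_lieExp_eq_symm_hasStrictFDerivAt (E := E) (G := G)
  let A : E →L[ℝ] F := mfderiv 𝓘(ℝ, E) 𝓘(ℝ, F) f 1
  have hh : HasStrictFDerivAt (φ ∘ f ∘ ψ.symm) A (ψ 1) := by
    have h1 := (contMDiffAt_iff.1 hf).2
    rw [ModelWithCorners.range_eq_univ, contDiffWithinAt_univ] at h1
    have h2 : HasFDerivWithinAt (φ ∘ f ∘ ψ.symm) A (range 𝓘(ℝ, E)) (ψ 1) :=
      (hf.mdifferentiableAt one_ne_zero).hasMFDerivAt.2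
    rw [ModelWithCorners.range_eq_univ, hasFDerivWithinAt_univ] at h2
    have h3 := h1.hasStrictFDerivAt one_ne_zero
    rwa [h2.fderiv] at h3
  obtain ⟨T, hT⟩ := A.exists_rightInverse_of_surjective (LinearMap.range_eq_top.2 hsurj)
  -- Restricting to the image of the right inverse `T` makes the derivative the identity of `F`, so
  -- the inverse function theorem applies. The parameter sought is `X = T (r (φ p))`.
  have hk : HasStrictFDerivAt ((φ ∘ f ∘ ψ.symm) ∘ e ∘ T)
      ((ContinuousLinearEquiv.refl ℝ F : F ≃L[ℝ] F) : F →L[ℝ] F) 0 := by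
    have h1 : HasStrictFDerivAt e (ContinuousLinearMap.id ℝ E) (T 0) := by rwa [map_zero]
    have h2 := h1.comp 0 T.hasStrictFDerivAt
    have h3 : HasStrictFDerivAt (φ ∘ f ∘ ψ.symm) A ((e ∘ T) 0) := by
      rwa [Function.comp_apply, map_zero, he0]
    refine (h3.comp 0 h2).congr_fderiv ?_
    rw [ContinuousLinearMap.id_comp, hT]
    rfl
  have hk0 : ((φ ∘ f ∘ ψ.symm) ∘ e ∘ T) 0 = φ (f 1) := by
    simp only [Function.comp_apply, map_zero, he0]
    rw [hψ, extChartAt_to_inv]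
  have hinv := hk.to_localInverse
  have hinv0 := hk.localInverse_apply_image
  have hright := hk.eventually_right_inverse
  set r := hk.localInverse
  rw [hk0] at hinv hinv0 hright
  obtain ⟨C, hC⟩ := hinv.hasFDerivAt.isBigO_sub.bound
  -- The big-O constant carries no sign, hence the absolute value; it is fixed before `U`.
  refine ⟨‖T‖ * |C|, by positivity, fun U hU => ?_⟩
  have hφc : Tendsto φ (𝓝 (f 1)) (𝓝 (φ (f 1))) := continuousAt_extChartAt (f 1)
  have hX : Tendsto (fun p => T (r (φ p))) (𝓝 (f 1)) (𝓝 0) := by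
    have h1 : Tendsto r (𝓝 (φ (f 1))) (𝓝 0) := by
      have := hinv.continuousAt.tendsto
      rwa [hinv0] at this
    have h2 : Tendsto T (𝓝 0) (𝓝 0) := T.continuous.tendsto' 0 0 (map_zero T)
    exact h2.comp (h1.comp hφc)
  have hsrc : ∀ᶠ X in 𝓝 (0 : E), f (ψ.symm (e X)) ∈ φ.source := by
    have h1 : Tendsto e (𝓝 0) (𝓝 (ψ 1)) := by
      have := he.continuousAt.tendsto
      rwa [he0] at this
    have h2 : Tendsto ψ.symm (𝓝 (ψ 1)) (𝓝 1) := by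
      have := (continuousAt_extChartAt_symm (I := 𝓘(ℝ, E)) (1 : G)).tendsto
      rwa [extChartAt_to_inv] at this
    exact (hf.continuousAt.tendsto.comp (h2.comp h1)).eventually
      (extChartAt_source_mem_nhds (I := 𝓘(ℝ, F)) (f 1))
  filter_upwards [hX.eventually hU, hX.eventually hexp, hX.eventually hsrc, hφc.eventually hright,
    hφc.eventually hC, extChartAt_source_mem_nhds (I := 𝓘(ℝ, F)) (f 1)]
    with p hpU hpexp hpsrc hpr hpC hp
  refine ⟨T (r (φ p)), hpU, ?_, ?_⟩
  · rw [hpexp]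
    exact φ.injOn hpsrc hp hpr
  · rw [hinv0, sub_zero] at hpC
    calc _ ≤ ‖T‖ * ‖r (φ p)‖ := T.le_opNorm _
      _ ≤ ‖T‖ * (|C| * ‖φ p - φ (f 1)‖) := by
        gcongr
        exact hpC.trans (by gcongr; exact le_abs_self C)
      _ = _ := by ring

end LocalSurjectivity

/-! ### Distance estimates for a metric tensor field. -/

section MetricTensorField

open MeasureTheory
open scoped NNReal ENNReal

variable {F : Type*} [NormedAddCommGroup F] [NormedSpace ℝ F]
  {M : Type*} [TopologicalSpace M] [ChartedSpace F M] [IsManifold 𝓘(ℝ, F) ∞ M]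

/-- The Riemannian distance of a metric tensor field, as an extended nonnegative real. -/
noncomputable def metricEDist (𝒢 : MetricTensorField F M) (p q : M) : ℝ≥0∞ :=
  letI : RiemannianBundle (fun p : M => TangentSpace 𝓘(ℝ, F) p) := ⟨𝒢.toRiemannianMetric⟩
  riemannianEDist 𝓘(ℝ, F) p q

/-- A curve of constant speed `√a`, parametrized by `[0, 1]`, bounds the distance between its
endpoints by `√a`. -/
theorem metricEDist_le_of_inner_eq (𝒢 : MetricTensorField F M) {γ : ℝ → M}
    (hγ : ContMDiff 𝓘(ℝ) 𝓘(ℝ, F) 1 γ) {a : ℝ}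
    (ha : ∀ t, 𝒢.inner (γ t) (mfderiv 𝓘(ℝ) 𝓘(ℝ, F) γ t (1 : ℝ))
      (mfderiv 𝓘(ℝ) 𝓘(ℝ, F) γ t (1 : ℝ)) = a) :
    metricEDist 𝒢 (γ 0) (γ 1) ≤ ENNReal.ofReal √a := by
  let _ : RiemannianBundle (fun p : M => TangentSpace 𝓘(ℝ, F) p) := ⟨𝒢.toRiemannianMetric⟩
  refine (riemannianEDist_le_pathELength hγ.contMDiffOn rfl rfl zero_le_one).trans ?_
  rw [pathELength_eq_lintegral_mfderiv_Icc]
  have hnorm : ∀ t, ‖mfderiv 𝓘(ℝ) 𝓘(ℝ, F) γ t (1 : ℝ)‖ₑ = ENNReal.ofReal √a := by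
    intro t
    rw [← ofReal_norm, norm_eq_sqrt_real_inner]
    exact congrArg (fun r => ENNReal.ofReal √r) (ha t)
  calc _ = ∫⁻ _ in Icc (0 : ℝ) 1, ENNReal.ofReal √a := lintegral_congr hnorm
    _ ≤ ENNReal.ofReal √a := by simp

/-- Finiteness is essential: `metricDist` is a `toReal`, which would turn an infinite distance into
`0`. -/
theorem exists_norm_extChartAt_sub_le_metricDist [RegularSpace M] (𝒢 : MetricTensorField F M)
    (x : M) (hfin : ∀ y, metricEDist 𝒢 x y ≠ ⊤) :
    ∃ C : ℝ, 0 ≤ C ∧ ∀ᶠ y in 𝓝 x,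
      ‖extChartAt 𝓘(ℝ, F) x y - extChartAt 𝓘(ℝ, F) x x‖ ≤ C * metricDist 𝒢 x y := by
  let _ : RiemannianBundle (fun p : M => TangentSpace 𝓘(ℝ, F) p) := ⟨𝒢.toRiemannianMetric⟩
  have : IsManifold 𝓘(ℝ, F) 1 M := IsManifold.of_le (n := ∞) (by exact_mod_cast le_top)
  have : IsContinuousRiemannianBundle F (fun p : M => TangentSpace 𝓘(ℝ, F) p) :=
    ⟨𝒢.inner, 𝒢.contMDiff.continuous, fun _ _ _ => rfl⟩
  obtain ⟨C, -, hC⟩ := eventually_edist_extChartAt_le_riemannianEDist (E := F) x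
  refine ⟨C, C.2, hC.mono fun y hy => ?_⟩
  have := ENNReal.toReal_mono (ENNReal.mul_ne_top ENNReal.coe_ne_top (hfin y)) hy
  rwa [edist_dist, ENNReal.toReal_ofReal dist_nonneg, dist_comm, dist_eq_norm,
    ENNReal.toReal_mul, ENNReal.coe_toReal] at this

/-- Every neighbourhood of `x` contains a Riemannian ball around `x`; its radius is the bound. -/
theorem exists_pos_le_metricDist [RegularSpace M] (𝒢 : MetricTensorField F M)
    (x : M) (hfin : ∀ y, metricEDist 𝒢 x y ≠ ⊤) {s : Set M} (hs : s ∈ 𝓝 x) :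
    ∃ c : ℝ, 0 < c ∧ ∀ y ∉ s, c ≤ metricDist 𝒢 x y := by
  let _ : RiemannianBundle (fun p : M => TangentSpace 𝓘(ℝ, F) p) := ⟨𝒢.toRiemannianMetric⟩
  have : IsManifold 𝓘(ℝ, F) 1 M := IsManifold.of_le (n := ∞) (by exact_mod_cast le_top)
  have : IsContinuousRiemannianBundle F (fun p : M => TangentSpace 𝓘(ℝ, F) p) :=
    ⟨𝒢.inner, 𝒢.contMDiff.continuous, fun _ _ _ => rfl⟩
  obtain ⟨c, c_pos, hc⟩ := setOfPred_riemannianEDist_lt_subset_nhds 𝓘(ℝ, F) hs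
  refine ⟨c, c_pos, fun y hy => ?_⟩
  have : (c : ℝ≥0∞) ≤ metricEDist 𝒢 x y := not_lt.1 fun h => hy (hc h)
  have h := ENNReal.toReal_mono (hfin y) this
  rwa [ENNReal.coe_toReal] at h

end MetricTensorField

/-! ### Constant speed of projected one-parameter subgroups. -/

section HomogeneousSpace

open scoped NNReal ENNReal

variable {E : Type*} [NormedAddCommGroup E] [NormedSpace ℝ E] [FiniteDimensional ℝ E]
  {F : Type*} [NormedAddCommGroup F] [NormedSpace ℝ F]
  {G : Type*} [TopologicalSpace G] [ChartedSpace E G] [Group G] [LieGroup 𝓘(ℝ, E) ∞ G]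
  {H : Subgroup G} [ChartedSpace F (G ⧸ H)] [IsManifold 𝓘(ℝ, F) ∞ (G ⧸ H)]

omit [FiniteDimensional ℝ E] in
/-- The projections to `G/H` of left-invariant vector fields have constant length, for a
`G`-invariant metric tensor field. -/
theorem inner_mfderiv_mk_mulInvariantVectorField
    (hπ : ContMDiff 𝓘(ℝ, E) 𝓘(ℝ, F) ∞ (QuotientGroup.mk : G → G ⧸ H))
    (𝒢 : MetricTensorField F (G ⧸ H)) (h𝒢 : 𝒢.IsInvariant (G := G))
    (X : GroupLieAlgebra 𝓘(ℝ, E) G) (g : G) :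
    𝒢.inner (QuotientGroup.mk g)
      (mfderiv 𝓘(ℝ, E) 𝓘(ℝ, F) (QuotientGroup.mk : G → G ⧸ H) g (mulInvariantVectorField X g))
      (mfderiv 𝓘(ℝ, E) 𝓘(ℝ, F) (QuotientGroup.mk : G → G ⧸ H) g (mulInvariantVectorField X g)) =
    𝒢.inner (QuotientGroup.mk 1) (projPushforward F H X) (projPushforward F H X) := by
  have hπd : MDifferentiable 𝓘(ℝ, E) 𝓘(ℝ, F) (QuotientGroup.mk : G → G ⧸ H) :=
    hπ.mdifferentiable (by simp)
  -- If the translation is differentiable, differentiate `π (g * x) = g • π x` at `1`. Otherwise its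
  -- `mfderiv` is the default `0`, and invariance with positive definiteness forces `F` to be
  -- trivial.
  by_cases hd : MDifferentiableAt 𝓘(ℝ, F) 𝓘(ℝ, F) (fun q : G ⧸ H => g • q) (QuotientGroup.mk 1)
  · have h1 := mfderiv_comp_apply_of_eq (1 : G) (hπd g) (mdifferentiable_mul_left' g 1)
      (mul_one g) X
    have h2 := mfderiv_comp_apply (1 : G) (g := fun q : G ⧸ H => g • q) hd (hπd 1) X
    have hcomp : (QuotientGroup.mk : G → G ⧸ H) ∘ (fun x => g * x) =
        (fun q : G ⧸ H => g • q) ∘ QuotientGroup.mk := rfl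
    have hbase : ∀ p q : G ⧸ H, p = q → ∀ v : F, 𝒢.inner p v v = 𝒢.inner q v v := by
      rintro p q rfl v; rfl
    have hg : (QuotientGroup.mk g : G ⧸ H) = g • (QuotientGroup.mk 1 : G ⧸ H) := by
      change _ = (QuotientGroup.mk (g * 1) : G ⧸ H)
      rw [mul_one]
    rw [← h𝒢 g (QuotientGroup.mk 1)]
    have key : (mfderiv 𝓘(ℝ, E) 𝓘(ℝ, F) (QuotientGroup.mk : G → G ⧸ H) g
        (mulInvariantVectorField X g) : F) =
        mfderiv 𝓘(ℝ, F) 𝓘(ℝ, F) (fun q : G ⧸ H => g • q) (QuotientGroup.mk 1)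
          (projPushforward F H X) := by
      refine h1.symm.trans ?_
      rw [hcomp]
      exact h2
    refine (hbase _ _ hg _).trans ?_
    exact congrArg (fun v : F => 𝒢.inner (g • (QuotientGroup.mk 1 : G ⧸ H)) v v) key
  · have hL : ∀ v : F, (mfderiv 𝓘(ℝ, F) 𝓘(ℝ, F) (fun q : G ⧸ H => g • q)
        (QuotientGroup.mk 1) v : F) = 0 := by
      intro v
      rw [mfderiv_zero_of_not_mdifferentiableAt hd]
      rfl
    have hinner_zero : ∀ p : G ⧸ H, 𝒢.inner p (0 : F) (0 : F) = 0 :=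
      fun p => map_zero (𝒢.inner p (0 : TangentSpace 𝓘(ℝ, F) p))
    have hzero : ∀ v : F, v = 0 := by
      intro v
      by_contra hv
      have h1 := h𝒢 g (QuotientGroup.mk 1) v v
      have h2 := congrArg (fun w : F => 𝒢.inner (g • (QuotientGroup.mk 1 : G ⧸ H)) w w) (hL v)
      exact (𝒢.pos (QuotientGroup.mk 1) v hv).ne' (h1.symm.trans (h2.trans (hinner_zero _)))
    have hz : ∀ (p : G ⧸ H) (v : F), 𝒢.inner p v v = 0 := by
      intro p v
      rw [hzero v]
      exact hinner_zero p
    exact (hz _ _).trans (hz _ _).symm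

variable [T2Space G]

/-- The distance from the base point to the projection of `exp X` is at most `‖X‖`. -/
theorem metricEDist_mk_lieExp_le
    (hπ : ContMDiff 𝓘(ℝ, E) 𝓘(ℝ, F) ∞ (QuotientGroup.mk : G → G ⧸ H))
    (𝒢 : MetricTensorField F (G ⧸ H)) (h𝒢 : 𝒢.IsInvariant (G := G))
    (X : GroupLieAlgebra 𝓘(ℝ, E) G) :
    metricEDist 𝒢 (QuotientGroup.mk 1) (QuotientGroup.mk (lieExp X)) ≤
      ENNReal.ofReal (inducedSeminorm 𝒢 X) := by
  have : CompleteSpace E := FiniteDimensional.complete ℝ E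
  have : IsManifold 𝓘(ℝ, E) 1 G := IsManifold.of_le (n := ∞) (by exact_mod_cast le_top)
  obtain ⟨γ, h0, h1, hγ⟩ := exists_isMIntegralCurve_lieExp X
  have hsmooth : ContMDiff 𝓘(ℝ) 𝓘(ℝ, F) 1 (fun t => (QuotientGroup.mk (γ t) : G ⧸ H)) :=
    (hπ.of_le (by exact_mod_cast le_top)).comp
      (hγ.contMDiff_one (contMDiff_one_mulInvariantVectorField X).continuous)
  rw [← h0, ← h1]
  refine metricEDist_le_of_inner_eq 𝒢 hsmooth fun t => ?_
  refine Eq.trans ?_ (inner_mfderiv_mk_mulInvariantVectorField hπ 𝒢 h𝒢 X (γ t))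
  have hd : (mfderiv 𝓘(ℝ) 𝓘(ℝ, F) (fun t => (QuotientGroup.mk (γ t) : G ⧸ H)) t (1 : ℝ) : F) =
      mfderiv 𝓘(ℝ, E) 𝓘(ℝ, F) (QuotientGroup.mk : G → G ⧸ H) (γ t)
        (mulInvariantVectorField X (γ t)) := by
    have h := ((hπ.mdifferentiable (by simp) (γ t)).hasMFDerivAt.comp t (hγ t)).mfderiv
    have h' := congr($h (1 : ℝ))
    refine h'.trans ?_
    change mfderiv 𝓘(ℝ, E) 𝓘(ℝ, F) (QuotientGroup.mk : G → G ⧸ H) (γ t)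
      ((1 : ℝ) • mulInvariantVectorField X (γ t)) = _
    rw [one_smul]
  exact congrArg (fun v : F => 𝒢.inner (QuotientGroup.mk (γ t) : G ⧸ H) v v) hd

end HomogeneousSpace

/-! ### Comparison of `ρ` with the distance. -/

section LogarithmicMetricEstimate

open scoped NNReal ENNReal

variable {E : Type*} [NormedAddCommGroup E] [NormedSpace ℝ E]
  {F : Type*} [NormedAddCommGroup F] [NormedSpace ℝ F]
  {G : Type*} [TopologicalSpace G] [ChartedSpace E G] [Group G]
  {H : Subgroup G} [ChartedSpace F (G ⧸ H)] [IsManifold 𝓘(ℝ, F) ∞ (G ⧸ H)]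

theorem exists_inducedSeminorm_le_norm (𝒢 : MetricTensorField F (G ⧸ H)) :
    ∃ C : ℝ, 0 ≤ C ∧ ∀ X : E, inducedSeminorm (E := E) 𝒢 X ≤ C * ‖X‖ := by
  let B : F →L[ℝ] F →L[ℝ] ℝ := 𝒢.inner (QuotientGroup.mk 1)
  let L : E →L[ℝ] F := mfderiv 𝓘(ℝ, E) 𝓘(ℝ, F) (QuotientGroup.mk : G → G ⧸ H) 1
  obtain ⟨c, hc, hB⟩ := B.isBoundedBilinearMap.bound
  refine ⟨√c * ‖L‖, by positivity, fun X => ?_⟩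
  have hBX : B (L X) (L X) ≤ c * (‖L‖ * ‖X‖) ^ 2 :=
    calc B (L X) (L X) ≤ ‖B (L X) (L X)‖ := Real.le_norm_self _
      _ ≤ c * ‖L X‖ * ‖L X‖ := hB _ _
      _ ≤ c * (‖L‖ * ‖X‖) * (‖L‖ * ‖X‖) := by gcongr <;> exact L.le_opNorm X
      _ = _ := by ring
  calc inducedSeminorm (E := E) 𝒢 X = √(B (L X) (L X)) := rfl
    _ ≤ √(c * (‖L‖ * ‖X‖) ^ 2) := Real.sqrt_le_sqrt hBX
    _ = √c * ‖L‖ * ‖X‖ := by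
      rw [Real.sqrt_mul hc.le, Real.sqrt_sq (by positivity), mul_assoc]

theorem logMetricEstimate_nonneg (𝒢 : MetricTensorField F (G ⧸ H))
    (log : G → GroupLieAlgebra 𝓘(ℝ, E) G) (p : G ⧸ H) : 0 ≤ logMetricEstimate 𝒢 log p :=
  Real.iInf_nonneg fun _ => Real.sqrt_nonneg _

theorem logMetricEstimate_mk_le (𝒢 : MetricTensorField F (G ⧸ H))
    (log : G → GroupLieAlgebra 𝓘(ℝ, E) G) (g : G) :
    logMetricEstimate 𝒢 log (QuotientGroup.mk g) ≤ inducedSeminorm 𝒢 (log g) :=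
  ciInf_le (f := fun g' : {g' : G // (QuotientGroup.mk g' : G ⧸ H) = QuotientGroup.mk g} =>
    inducedSeminorm 𝒢 (log g')) ⟨0, by rintro _ ⟨_, rfl⟩; exact Real.sqrt_nonneg _⟩ ⟨g, rfl⟩

theorem distToBase_nonneg (𝒢 : MetricTensorField F (G ⧸ H)) (p : G ⧸ H) : 0 ≤ distToBase 𝒢 p :=
  ENNReal.toReal_nonneg

variable [LieGroup 𝓘(ℝ, E) ∞ G] [T2Space G] [FiniteDimensional ℝ E]
  {V : Set (GroupLieAlgebra 𝓘(ℝ, E) G)} {log : G → GroupLieAlgebra 𝓘(ℝ, E) G}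

theorem metricEDist_mk_le_of_isLieLog
    (hπ : ContMDiff 𝓘(ℝ, E) 𝓘(ℝ, F) ∞ (QuotientGroup.mk : G → G ⧸ H))
    (𝒢 : MetricTensorField F (G ⧸ H)) (h𝒢 : 𝒢.IsInvariant (G := G)) (hlog : IsLieLog V log)
    (g : G) :
    metricEDist 𝒢 (QuotientGroup.mk 1) (QuotientGroup.mk g) ≤
      ENNReal.ofReal (inducedSeminorm 𝒢 (log g)) := by
  have h := metricEDist_mk_lieExp_le hπ 𝒢 h𝒢 (log g)
  rwa [hlog.exp_log] at h

/-- The logarithm is defined on all of `G`, so a projected exponential curve of finite length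
reaches every point. -/
theorem metricEDist_mk_one_ne_top
    (hπ : ContMDiff 𝓘(ℝ, E) 𝓘(ℝ, F) ∞ (QuotientGroup.mk : G → G ⧸ H))
    (𝒢 : MetricTensorField F (G ⧸ H)) (h𝒢 : 𝒢.IsInvariant (G := G)) (hlog : IsLieLog V log)
    (p : G ⧸ H) : metricEDist 𝒢 (QuotientGroup.mk 1) p ≠ ⊤ := by
  obtain ⟨g, rfl⟩ := QuotientGroup.mk_surjective p
  exact ne_top_of_le_ne_top ENNReal.ofReal_ne_top (metricEDist_mk_le_of_isLieLog hπ 𝒢 h𝒢 hlog g)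

/-- The logarithmic metric estimate dominates the distance to the base point. -/
theorem distToBase_le_logMetricEstimate
    (hπ : ContMDiff 𝓘(ℝ, E) 𝓘(ℝ, F) ∞ (QuotientGroup.mk : G → G ⧸ H))
    (𝒢 : MetricTensorField F (G ⧸ H)) (h𝒢 : 𝒢.IsInvariant (G := G)) (hlog : IsLieLog V log)
    (p : G ⧸ H) : distToBase 𝒢 p ≤ logMetricEstimate 𝒢 log p := by
  obtain ⟨g₀, hg₀⟩ := QuotientGroup.mk_surjective p
  have : Nonempty {g : G // (QuotientGroup.mk g : G ⧸ H) = p} := ⟨⟨g₀, hg₀⟩⟩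
  refine le_ciInf fun ⟨g, hg⟩ => ?_
  subst hg
  exact ENNReal.toReal_le_of_le_ofReal (Real.sqrt_nonneg _)
    (metricEDist_mk_le_of_isLieLog hπ 𝒢 h𝒢 hlog g)

omit [T2Space G] in
/-- The logarithmic metric estimate is locally bounded. -/
theorem exists_eventually_logMetricEstimate_le (𝒢 : MetricTensorField F (G ⧸ H))
    (hlog : IsLieLog V log) (p : G ⧸ H) :
    ∃ R : ℝ, ∀ᶠ q in 𝓝 p, logMetricEstimate 𝒢 log q ≤ R := by
  have : IsTopologicalGroup G := topologicalGroup_of_lieGroup 𝓘(ℝ, E) ∞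
  have : LocallyCompactSpace E := inferInstance
  have : LocallyCompactSpace G := ChartedSpace.locallyCompactSpace E G
  obtain ⟨g, rfl⟩ := QuotientGroup.mk_surjective p
  -- `log` need not be continuous: its boundedness on a compact neighbourhood is used instead,
  -- pushed to the quotient by openness of `π`.
  obtain ⟨S, hS, hSg⟩ := exists_compact_mem_nhds g
  obtain ⟨B, hB, hmaps⟩ := hlog.locallyBounded S hS
  obtain ⟨C, hC, hle⟩ := exists_inducedSeminorm_le_norm (E := E) 𝒢
  obtain ⟨R, hR⟩ := IsCompact.exists_bound_of_continuousOn (α := E) (E := E) (f := id) hB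
    continuous_id.continuousOn
  refine ⟨C * R, ?_⟩
  filter_upwards [QuotientGroup.isOpenMap_coe.image_mem_nhds hSg] with q hq
  obtain ⟨g', hg', rfl⟩ := hq
  exact (logMetricEstimate_mk_le 𝒢 log g').trans ((hle _).trans
    (mul_le_mul_of_nonneg_left (hR _ (hmaps hg')) hC))

variable [FiniteDimensional ℝ F]

/-- Near the base point, the logarithmic metric estimate is bounded by a multiple of the distance
to the base point. -/
theorem exists_eventually_logMetricEstimate_le_mul_distToBase [RegularSpace (G ⧸ H)]
    (hπ : IsSubmersion 𝓘(ℝ, E) 𝓘(ℝ, F) ∞ (QuotientGroup.mk : G → G ⧸ H))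
    (𝒢 : MetricTensorField F (G ⧸ H)) (h𝒢 : 𝒢.IsInvariant (G := G)) (hlog : IsLieLog V log) :
    ∃ C : ℝ, ∀ᶠ p in 𝓝 (QuotientGroup.mk 1 : G ⧸ H),
      logMetricEstimate 𝒢 log p ≤ C * distToBase 𝒢 p := by
  have hsmooth := hπ.contMDiff
  obtain ⟨C₁, hC₁, h₁⟩ := exists_inducedSeminorm_le_norm (E := E) 𝒢
  obtain ⟨C₂, hC₂, h₂⟩ := exists_lieExp_eq_norm_le (f := (QuotientGroup.mk : G → G ⧸ H))
    ((hsmooth.of_le (by exact_mod_cast le_top)).contMDiffAt)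
    (hπ.isSubmersionAt 1).isSubmersionAtOfComplement_complement.mfderiv_surjective
  obtain ⟨C₃, -, h₃⟩ := exists_norm_extChartAt_sub_le_metricDist 𝒢 (QuotientGroup.mk 1)
    (metricEDist_mk_one_ne_top hsmooth 𝒢 h𝒢 hlog)
  refine ⟨C₁ * (C₂ * C₃), ?_⟩
  -- Taking `U = V` places `X` where `log` inverts `exp`, so the representative `exp X` of the coset
  -- has logarithm `X`.
  filter_upwards [h₂ V hlog.mem_nhds, h₃] with p ⟨X, hXV, hXp, hX⟩ hp
  subst hXp
  calc _ ≤ inducedSeminorm 𝒢 (log (lieExp (E := E) (G := G) X)) := logMetricEstimate_mk_le 𝒢 log _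
    _ = inducedSeminorm (E := E) 𝒢 X := by rw [hlog.log_exp X hXV]
    _ ≤ C₁ * ‖X‖ := h₁ X
    _ ≤ C₁ * (C₂ * (C₃ * distToBase 𝒢 (QuotientGroup.mk (lieExp (E := E) (G := G) X)))) := by
      gcongr
      exact hX.trans (mul_le_mul_of_nonneg_left hp hC₂)
    _ = _ := by ring

/-- On compact subsets of `G/H`, the logarithmic metric estimate and the distance to the base point
are equivalent. -/
theorem exists_isMetricConstant (hHc : IsCompact (H : Set G))
    (hπ : IsSubmersion 𝓘(ℝ, E) 𝓘(ℝ, F) ∞ (QuotientGroup.mk : G → G ⧸ H))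
    (𝒢 : MetricTensorField F (G ⧸ H)) (h𝒢 : 𝒢.IsInvariant (G := G)) (hlog : IsLieLog V log)
    {K : Set (G ⧸ H)} (hK : IsCompact K) : ∃ C, IsMetricConstant 𝒢 log K C := by
  have : IsTopologicalGroup G := topologicalGroup_of_lieGroup 𝓘(ℝ, E) ∞
  -- Closedness of `H` makes `G ⧸ H` Hausdorff, and local compactness then makes it regular.
  have : IsClosed (H : Set G) := hHc.isClosed
  have : LocallyCompactSpace (G ⧸ H) := ChartedSpace.locallyCompactSpace F (G ⧸ H)
  have hsmooth := hπ.contMDiff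
  suffices h : ∃ C : ℝ, ∀ p ∈ K, logMetricEstimate 𝒢 log p ≤ C * distToBase 𝒢 p by
    obtain ⟨C, hC⟩ := h
    refine ⟨max 1 C, le_max_left _ _, fun p hp =>
      ⟨distToBase_le_logMetricEstimate hsmooth 𝒢 h𝒢 hlog p, (hC p hp).trans ?_⟩⟩
    exact mul_le_mul_of_nonneg_right (le_max_right _ _) (distToBase_nonneg 𝒢 p)
  refine hK.induction_on (p := fun s => ∃ C : ℝ, ∀ p ∈ s,
    logMetricEstimate 𝒢 log p ≤ C * distToBase 𝒢 p) ⟨0, by simp⟩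
    (fun s t hst ⟨C, hC⟩ => ⟨C, fun p hp => hC p (hst hp)⟩) ?_ ?_
  · rintro s t ⟨C, hC⟩ ⟨D, hD⟩
    refine ⟨max C D, fun p hp => ?_⟩
    rcases hp with hp | hp
    · exact (hC p hp).trans
        (mul_le_mul_of_nonneg_right (le_max_left _ _) (distToBase_nonneg 𝒢 p))
    · exact (hD p hp).trans
        (mul_le_mul_of_nonneg_right (le_max_right _ _) (distToBase_nonneg 𝒢 p))
  · intro p _
    suffices h : ∃ C : ℝ, ∀ᶠ q in 𝓝 p, logMetricEstimate 𝒢 log q ≤ C * distToBase 𝒢 q by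
      obtain ⟨C, hC⟩ := h
      exact ⟨_, mem_nhdsWithin_of_mem_nhds hC, C, fun q hq => hq⟩
    by_cases hp : p = QuotientGroup.mk 1
    · rw [hp]
      exact exists_eventually_logMetricEstimate_le_mul_distToBase hπ 𝒢 h𝒢 hlog
    · obtain ⟨s, hs, t, ht, hst⟩ := Filter.disjoint_iff.1 (disjoint_nhds_nhds.2 (Ne.symm hp))
      obtain ⟨c, hc, hdist⟩ := exists_pos_le_metricDist 𝒢 (QuotientGroup.mk 1)
        (metricEDist_mk_one_ne_top hsmooth 𝒢 h𝒢 hlog) hs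
      obtain ⟨R, hR⟩ := exists_eventually_logMetricEstimate_le 𝒢 hlog p
      -- Away from `p₀`: `ρ ≤ R` and `d ≥ c > 0`.
      refine ⟨R / c, ?_⟩
      filter_upwards [hR, ht] with q hqR hqt
      have hR0 : 0 ≤ R := (logMetricEstimate_nonneg 𝒢 log q).trans hqR
      calc _ ≤ R := hqR
        _ = R / c * c := by field_simp
        _ ≤ R / c * distToBase 𝒢 q := by
          gcongr
          exact hdist q (disjoint_right.1 hst hqt)

end LogarithmicMetricEstimate

/-! ### Monotonicity and homogeneity of the kernel profile. -/

section MorphProfile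

theorem morphProfile_of_ne {α t r : ℝ} (hα : α ≠ 1 / 2) : morphProfile α t r =
    ((morphNu α * t ^ (-(1 / (2 * α - 1))) * r ^ (2 * α / (2 * α - 1)) : ℝ) : EReal) :=
  if_neg hα

theorem morphProfile_half (t r : ℝ) :
    morphProfile (1 / 2) t r = if r ^ (2 * (1 / 2) : ℝ) ≤ t then 0 else ⊤ :=
  if_pos rfl

theorem morphNu_nonneg {α : ℝ} (hα : 1 / 2 < α) : 0 ≤ morphNu α :=
  div_nonneg (by linarith) (Real.rpow_nonneg (by linarith) _)

theorem morphProfile_mono {α t r s : ℝ} (hα : 1 / 2 < α) (ht : 0 < t) (hr : 0 ≤ r) (hrs : r ≤ s) :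
    morphProfile α t r ≤ morphProfile α t s := by
  rw [morphProfile_of_ne hα.ne', morphProfile_of_ne hα.ne', EReal.coe_le_coe_iff]
  have := morphNu_nonneg hα
  have : 0 ≤ 2 * α / (2 * α - 1) := div_nonneg (by linarith) (by linarith)
  gcongr

theorem morphProfile_mul {α t C r : ℝ} (hα : 1 / 2 < α) (hC : 0 ≤ C) (hr : 0 ≤ r) :
    morphProfile α t (C * r) =
      ((C ^ (2 * α / (2 * α - 1)) : ℝ) : EReal) * morphProfile α t r := by
  rw [morphProfile_of_ne hα.ne', morphProfile_of_ne hα.ne', ← EReal.coe_mul,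
    Real.mul_rpow hC hr]
  congr 1
  ring

end MorphProfile

theorem mainTheorem5
    {E : Type*} [NormedAddCommGroup E] [NormedSpace ℝ E] [FiniteDimensional ℝ E]
    {F : Type*} [NormedAddCommGroup F] [NormedSpace ℝ F] [FiniteDimensional ℝ F]
    -- a connected Lie group `G` with a compact connected subgroup `H`
    {G : Type*} [TopologicalSpace G] [T2Space G] [ConnectedSpace G] [ChartedSpace E G] [Group G]
    [LieGroup 𝓘(ℝ, E) ∞ G]
    (H : Subgroup G) (hHc : IsCompact (H : Set G)) (hHconn : IsConnected (H : Set G))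
    -- the smooth structure of `G/H`: the one for which the projection is a smooth submersion
    [ChartedSpace F (G ⧸ H)] [IsManifold 𝓘(ℝ, F) ∞ (G ⧸ H)]
    (hπ : IsSubmersion 𝓘(ℝ, E) 𝓘(ℝ, F) ∞ (QuotientGroup.mk : G → G ⧸ H))
    (𝒢 : MetricTensorField F (G ⧸ H)) (h𝒢 : 𝒢.IsInvariant)
    (V : Set (GroupLieAlgebra 𝓘(ℝ, E) G)) (log : G → GroupLieAlgebra 𝓘(ℝ, E) G)
    (hlog : IsLieLog V log) :
    -- `k ≤ k^appr` everywhere, for `1/2 < α ≤ 1`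
    (∀ α ∈ Ioc (1 / 2 : ℝ) 1, ∀ t : ℝ, 0 < t → ∀ p : G ⧸ H,
      morphKernel 𝒢 α t p ≤ approxMorphKernel 𝒢 log α t p) ∧
    -- on every compact set there is a constant `C_metr`, and each such constant bounds `k^appr`
    (∀ K : Set (G ⧸ H), IsCompact K →
      (∃ C, IsMetricConstant 𝒢 log K C) ∧
      ∀ C, IsMetricConstant 𝒢 log K C →
        ∀ α ∈ Ioc (1 / 2 : ℝ) 1, ∀ t : ℝ, 0 < t → ∀ p ∈ K,
          approxMorphKernel 𝒢 log α t p ≤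
            ((C ^ (2 * α / (2 * α - 1)) : ℝ) : EReal) * morphKernel 𝒢 α t p) ∧
    -- the case `α = 1/2`
    (∀ t : ℝ, 0 < t → ∀ p : G ⧸ H,
      (logMetricEstimate 𝒢 log p ^ (2 * (1 / 2) : ℝ) ≤ t →
        approxMorphKernel 𝒢 log (1 / 2) t p = 0 ∧ morphKernel 𝒢 (1 / 2) t p = 0) ∧
      (t < distToBase 𝒢 p ^ (2 * (1 / 2) : ℝ) →
        approxMorphKernel 𝒢 log (1 / 2) t p = ⊤ ∧ morphKernel 𝒢 (1 / 2) t p = ⊤) ∧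
      (t < logMetricEstimate 𝒢 log p ^ (2 * (1 / 2) : ℝ) →
        distToBase 𝒢 p ^ (2 * (1 / 2) : ℝ) ≤ t →
        approxMorphKernel 𝒢 log (1 / 2) t p = ⊤ ∧ morphKernel 𝒢 (1 / 2) t p = 0)) := by

  have hsmooth := hπ.contMDiff
  have hle := distToBase_le_logMetricEstimate hsmooth 𝒢 h𝒢 hlog
  have hd := distToBase_nonneg 𝒢
  refine ⟨fun α hα t ht p => morphProfile_mono hα.1 ht (hd p) (hle p), fun K hK =>
    ⟨exists_isMetricConstant hHc hπ 𝒢 h𝒢 hlog hK, fun C hC α hα t ht p hp => ?_⟩,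
    fun t ht p => ?_⟩
  · refine (morphProfile_mono hα.1 ht (logMetricEstimate_nonneg 𝒢 log p) (hC.2 p hp).2).trans_eq ?_
    exact morphProfile_mul hα.1 (zero_le_one.trans hC.1) (hd p)
  -- The exponent equals `1`, so these are the plain thresholds `ρ ≤ t` and `d ≤ t`.
  · have hpow : distToBase 𝒢 p ^ (2 * (1 / 2) : ℝ) ≤
        logMetricEstimate 𝒢 log p ^ (2 * (1 / 2) : ℝ) :=
      Real.rpow_le_rpow (hd p) (hle p) (by norm_num)
    simp only [approxMorphKernel, morphKernel, morphProfile_half]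
    refine ⟨fun h => ⟨if_pos h, if_pos (hpow.trans h)⟩, fun h => ⟨if_neg ?_, if_neg h.not_ge⟩,
      fun h h' => ⟨if_neg h.not_ge, if_pos h'⟩⟩
    exact (h.trans_le hpow).not_ge
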